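/- Let $(R,\mathfrak m)$ be a Noetherian local ring of Krull dimension $d\ge 2$ with $\operatorname{depth} R\ge d-1$, and let $\mathfrak q\subseteq R$ be a parameter ideal, i.e. an $\mathfrak m$-primary ideal generated by $d$ elements. Writing $\lambda$ for length, there is a (unique) polynomial $h(t)\in\mathbb Z[t]$ with $$\sum_{n\ge 0}\lambda(\mathfrak q^n/\mathfrak q^{n+1})\,t^n=\frac{h(t)}{(1-t)^d},$$ and the second Hilbert coefficient $e_2(\mathfrak q):=h''(1)/2!$ of the $\mathfrak q$-adic filtration satisfies $e_2(\mathfrak q)\le 0$. -/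

import Mathlib

open scoped Polynomial

noncomputable section

namespace HilbertCoeff

/-- The depth of a module `M` over a local ring `(R, 𝔪)`: the supremum of the lengths of the
`M`-regular sequences contained in `𝔪`. -/
def depth (R M : Type*) [CommRing R] [IsLocalRing R] [AddCommGroup M] [Module R M] : ℕ∞ :=
  ⨆ rs ∈ {rs : List R | RingTheory.Sequence.IsRegular M rs ∧
    ∀ r ∈ rs, r ∈ IsLocalRing.maximalIdeal R}, (rs.length : ℕ∞)

/-- A parameter ideal of a local ring `(R, 𝔪)` of dimension `d`: an `𝔪`-primary ideal generated
by `d` elements. -/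
def IsParameterIdeal {R : Type*} [CommRing R] [IsLocalRing R] (q : Ideal R) : Prop :=
  q.radical = IsLocalRing.maximalIdeal R ∧
    ∃ (d : ℕ) (x : Fin d → R), (d : WithBot ℕ∞) = ringKrullDim R ∧ Ideal.span (Set.range x) = q

section Filtration

variable {R M : Type*} [CommRing R] [AddCommGroup M] [Module R M] {q : Ideal R}

/-- The Hilbert function `n ↦ λ(M_n / M_{n+1})` of a `q`-filtration `F = {M_n}` of `M`. -/
def hilbertFunction (F : q.Filtration M) (n : ℕ) : ℕ :=
  (Module.length R (F.N n ⧸ (F.N (n + 1)).submoduleOf (F.N n))).toNat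

/-- The Hilbert series `∑ λ(M_n / M_{n+1}) tⁿ` of a filtration. -/
def hilbertSeries (F : q.Filtration M) : PowerSeries ℤ :=
  PowerSeries.mk fun n => (hilbertFunction F n : ℤ)

/-- The dimension of `M` as a natural number (`0` for the zero module). -/
def dim (R M : Type*) [CommRing R] [AddCommGroup M] [Module R M] : ℕ :=
  ((Module.supportDim R M).unbotD 0).toNat

/-- `h ∈ ℤ[t]` is the `h`-polynomial of the filtration `F`: the Hilbert series equals
`h(t) / (1 - t)^d`, where `d = dim M`. As `d` is fixed, `h` is unique
(see `IsHPolynomial.unique`). -/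
def IsHPolynomial (F : q.Filtration M) (h : ℤ[X]) : Prop :=
  hilbertSeries F * (1 - PowerSeries.X) ^ dim R M = (h : PowerSeries ℤ)

theorem IsHPolynomial.unique {F : q.Filtration M} {h₁ h₂ : ℤ[X]}
    (H₁ : IsHPolynomial F h₁) (H₂ : IsHPolynomial F h₂) : h₁ = h₂ :=
  Polynomial.coe_injective ℤ (H₁.symm.trans H₂)

open Classical in
/-- The `h`-polynomial of a filtration (`0` if there is none). -/
def hPolynomial (F : q.Filtration M) : ℤ[X] :=
  if H : ∃ h, IsHPolynomial F h then H.choose else 0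

theorem IsHPolynomial.eq_hPolynomial {F : q.Filtration M} {h : ℤ[X]} (H : IsHPolynomial F h) :
    hPolynomial F = h := by
  have hex : ∃ h, IsHPolynomial F h := ⟨h, H⟩
  rw [hPolynomial, dif_pos hex]
  exact hex.choose_spec.unique H

/-- The `i`-th Hilbert coefficient `e_i = h^{(i)}(1) / i!` of a filtration; the Hasse derivative
of order `i` is the `i`-th derivative divided by `i!`. -/
def hilbertCoeff (F : q.Filtration M) (i : ℕ) : ℤ :=
  (Polynomial.hasseDeriv i (hPolynomial F)).eval 1

end Filtration

/-- The `q`-adic filtration `{qⁿ}` of the ring `R`. -/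
abbrev adicFiltration {R : Type*} [CommRing R] (q : Ideal R) : q.Filtration R :=
  q.stableFiltration (⊤ : Submodule R R)

end HilbertCoeff

end

/-! Induct on the number of generators of `q`, dividing out a superficial nonzerodivisor `y ∈ q`
until `q` is principal. Multiplication by `y` gives an exact sequence `R/qⁿ → R/qⁿ⁺¹ → R/(qⁿ⁺¹ +
(y)) → 0`, whose first map is injective for large `n`. So the `h`-polynomials of `R` and `R/(y)`
differ by `(1 - t)ᵏ v` with `v ≥ 0` coefficientwise; here `k ≥ 2`, and `e₂(R) ≤ e₂(R/(y))`, with a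
drop of `v(1)` when `k = 2` and equality otherwise (`HasNonposSecondCoeff.of_superficial`). In the
principal case multiplication by the generator makes the Hilbert function nonincreasing, so `h` has
nonpositive coefficients in positive degrees and `e₂ = ∑ C(n,2) hₙ ≤ 0`.

The superficial element is the generic combination `∑ xᵢ Xⁱ` in the Nagata ring `R(X)`, a flat local
extension preserving colengths; no infinite residue field is needed. It is superficial by a graded
McCoy argument (`mem_map_pow_of_genericElement_mul_mem`), fed by `qⁿ⁺¹ : q = qⁿ` for large `n`.
Depth survives the extension by flatness and drops by at most one in the quotient by Ext vanishing.
-/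

namespace HilbertCoeff

/-! ### Colon ideals of powers and generic superficial elements -/

section RatliffRush

variable {R : Type*} [CommRing R]

/-- If an ideal `q` of a Noetherian ring contains a nonzerodivisor, then `q ^ (n + 1) : q = q ^ n`
for all large `n`. -/
theorem eventually_mem_pow_of_mul_mem_pow_succ [IsNoetherianRing R] (q : Ideal R) {z : R}
    (hz : z ∈ q) (hreg : z ∈ nonZeroDivisors R) :
    ∃ n₀, ∀ n ≥ n₀, ∀ a : R, (∀ b ∈ q, b * a ∈ q ^ (n + 1)) → a ∈ q ^ n := by
  -- As `F` lies inside the `q`-adic filtration, Artin–Rees makes it stable; cancelling `z` then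
  -- gives `qⁿ⁺¹ : q = q (qⁿ : q) ⊆ qⁿ` for large `n`.
  let F : q.Filtration R :=
    { N := fun n ↦ Submodule.map (LinearMap.mulLeft R z) ((q ^ (n + 1)).colon (q : Set R))
      mono := fun n ↦ Submodule.map_mono
        (Submodule.colon_mono (Ideal.pow_le_pow_right (Nat.le_succ _)) subset_rfl)
      smul_le := fun n ↦ by
        refine (Submodule.map_smul'' _ _ _).symm.le.trans ?_
        refine Submodule.map_mono ?_
        rw [smul_eq_mul, Ideal.mul_le]
        intro r hr s hs
        rw [Submodule.mem_colon] at hs ⊢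
        intro p hp
        have := Ideal.mul_mem_mul hr (hs p hp)
        rw [← pow_succ'] at this
        simpa [mul_assoc] using this }
  have hle : F ≤ q.stableFiltration ⊤ := by
    intro n
    rintro _ ⟨a, ha, rfl⟩
    have := (Submodule.mem_colon.mp ha) z hz
    have h2 : z * a ∈ q ^ n := Ideal.pow_le_pow_right (Nat.le_succ n) (by simpa [mul_comm] using this)
    simpa using h2
  obtain ⟨n₀, hn₀⟩ := ((q.stableFiltration_stable ⊤).of_le hle)
  refine ⟨n₀ + 1, fun n hn a ha ↦ ?_⟩
  obtain ⟨m, rfl⟩ : ∃ m, n = m + 1 := ⟨n - 1, by omega⟩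
  have hmem : z * a ∈ F.N (m + 1) := by
    refine ⟨a, ?_, rfl⟩
    refine Submodule.mem_colon.mpr fun p hp ↦ ?_
    simpa [mul_comm] using ha p hp
  rw [← hn₀ m (by omega)] at hmem
  replace hmem := (Submodule.map_smul'' _ _ _).symm.le hmem
  obtain ⟨c, hc, hca⟩ := hmem
  have : c = a := (mul_cancel_left_mem_nonZeroDivisors hreg).mp hca
  subst this
  refine (?_ : q • (q ^ (m + 1)).colon (q : Set R) ≤ q ^ (m + 1)) hc
  rw [smul_eq_mul, Ideal.mul_le]
  intro r hr s hs
  simpa [mul_comm] using (Submodule.mem_colon.mp hs) r hr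

/-- The polynomial `∑ xᵢ Xⁱ`, a generic linear combination of the `xᵢ`. -/
noncomputable def genericElement {d : ℕ} (x : Fin d → R) : R[X] :=
  ∑ i : Fin d, Polynomial.monomial (i : ℕ) (x i)

theorem genericElement_coeff {d : ℕ} (x : Fin d → R) (i : Fin d) :
    (genericElement x).coeff i = x i := by
  simp [genericElement, Polynomial.coeff_monomial, Fin.val_inj]

theorem genericElement_coeff_of_le {d : ℕ} (x : Fin d → R) {i : ℕ} (hi : d ≤ i) :
    (genericElement x).coeff i = 0 := by
  simp only [genericElement, Polynomial.finsetSum_coeff, Polynomial.coeff_monomial]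
  exact Finset.sum_eq_zero fun j _ ↦ if_neg (by omega)

theorem genericElement_coeff_mem {d : ℕ} (x : Fin d → R) (i : ℕ) :
    (genericElement x).coeff i ∈ Ideal.span (Set.range x) := by
  by_cases h : i < d
  · rw [show i = ((⟨i, h⟩ : Fin d) : ℕ) from rfl, genericElement_coeff]
    exact Ideal.subset_span ⟨_, rfl⟩
  · rw [genericElement_coeff_of_le x (not_lt.mp h)]
    exact zero_mem _

/-- McCoy: a zero divisor in `R[X]` is killed by a nonzero constant, which here kills every `x i`.
-/
theorem genericElement_mem_nonZeroDivisors {d : ℕ} (x : Fin d → R)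
    (h : ∀ a : R, (∀ b ∈ Ideal.span (Set.range x), b * a = 0) → a = 0) :
    genericElement x ∈ nonZeroDivisors R[X] := by
  refine Polynomial.mem_nonZeroDivisors_iff.mpr fun a ha ↦ h a fun b hb ↦ ?_
  refine Submodule.span_induction ?_ (zero_mul a) (fun _ _ _ _ h₁ h₂ ↦ ?_) (fun c y _ hy ↦ ?_) hb
  · rintro _ ⟨i, rfl⟩
    have := congr($(ha).coeff i)
    simpa [genericElement_coeff, mul_comm] using this
  · rw [add_mul, h₁, h₂, add_zero]
  · rw [smul_eq_mul, mul_assoc, hy, mul_zero]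

/-- A graded form of McCoy's theorem: if `q ^ (n + 1) : q = q ^ n` for all large `n`, where `q`
is generated by the `xᵢ`, then the generic combination of the `xᵢ` has the same property over
the polynomial ring. -/
theorem mem_map_pow_of_genericElement_mul_mem {d : ℕ} (x : Fin d → R) {n₀ : ℕ}
    (h : ∀ n ≥ n₀, ∀ a : R, (∀ b ∈ Ideal.span (Set.range x),
      b * a ∈ Ideal.span (Set.range x) ^ (n + 1)) → a ∈ Ideal.span (Set.range x) ^ n)
    {n : ℕ} (hn : n₀ ≤ n) (f : R[X])
    (hf : genericElement x * f ∈ (Ideal.span (Set.range x) ^ (n + 1)).map Polynomial.C) :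
    f ∈ (Ideal.span (Set.range x) ^ n).map Polynomial.C := by
  set q := Ideal.span (Set.range x) with hq
  set g := genericElement x with hg
  -- Induction on the degree bound with `n` free: the step applies the hypothesis at `n + 1`.
  suffices H : ∀ k n : ℕ, n₀ ≤ n → ∀ f : R[X], f.degree < k →
      g * f ∈ (q ^ (n + 1)).map Polynomial.C → f ∈ (q ^ n).map Polynomial.C from
    H (f.natDegree + 1) n hn f (Polynomial.degree_le_natDegree.trans_lt
      (by exact_mod_cast Nat.lt_succ_self _)) hf
  intro k
  induction k with
  | zero =>
    intro n _ f hdeg _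
    have h0 : f = 0 := 
      Polynomial.ext fun m ↦ (Polynomial.degree_lt_iff_coeff_zero f 0).mp hdeg m m.zero_le
    rw [h0]
    exact zero_mem _
  | succ k ih =>
    intro n hn f hdeg hgf
    suffices hall : ∀ i j, g.coeff i * f.coeff j ∈ q ^ (n + 1) by
      refine Ideal.mem_map_C_iff.mpr fun j ↦ h n hn _ fun b hb ↦ ?_
      refine Submodule.span_induction ?_ (by simp) (fun _ _ _ _ h₁ h₂ ↦ ?_)
        (fun c y _ hy ↦ ?_) hb
      · rintro _ ⟨i, rfl⟩
        rw [← genericElement_coeff x i]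
        exact hall i j
      · rw [add_mul]
        exact add_mem h₁ h₂
      · rw [smul_eq_mul, mul_assoc]
        exact Ideal.mul_mem_left _ _ hy
    -- Descending induction on `i`, starting where the coefficients of `g` vanish.
    suffices hdesc : ∀ e i : ℕ, d ≤ i + e → ∀ j, g.coeff i * f.coeff j ∈ q ^ (n + 1) from
      fun i ↦ hdesc d i (by omega)
    intro e
    induction e with
    | zero =>
      intro i hi j
      rw [hg, genericElement_coeff_of_le x (by omega : d ≤ i), zero_mul]
      exact zero_mem _
    | succ e ihe =>
      intro i hi
      -- In the coefficient of `g * f` at `i + k`, terms with a larger index on `g` are already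
      -- known, and the others involve coefficients of `f` beyond `k`.
      have hlead : g.coeff i * f.coeff k ∈ q ^ (n + 1) := by
        have hc := Ideal.mem_map_C_iff.mp hgf (i + k)
        rw [Polynomial.coeff_mul,
          ← Finset.add_sum_erase _ _
            (Finset.HasAntidiagonal.mem_antidiagonal.mpr rfl : (i, k) ∈ _)] at hc
        refine (Ideal.add_mem_iff_left _ (Ideal.sum_mem _ ?_)).mp hc
        rintro ⟨a, b⟩ hab
        simp only [Finset.mem_erase, Finset.HasAntidiagonal.mem_antidiagonal, ne_eq,
          Prod.mk.injEq] at hab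
        by_cases hai : i < a
        · exact ihe a (by omega) b
        · rw [Polynomial.coeff_eq_zero_of_degree_lt (n := b), mul_zero]
          · exact zero_mem _
          · refine lt_of_lt_of_le hdeg ?_
            exact_mod_cast (show k + 1 ≤ b by omega)
      have hgi : g.coeff i ∈ q := genericElement_coeff_mem x i
      have hgq : g ∈ q.map Polynomial.C :=
        Ideal.mem_map_C_iff.mpr fun i ↦ genericElement_coeff_mem x i
      -- The factor `g.coeff i ∈ q` raises the power by one, and removing the top term lowers the
      -- degree.
      have key : Polynomial.C (g.coeff i) * f.erase k ∈ (q ^ (n + 1)).map Polynomial.C := by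
        refine ih (n + 1) (by omega) _ ?_ ?_
        · rw [Polynomial.degree_lt_iff_coeff_zero]
          intro m hm
          rw [Polynomial.coeff_C_mul, Polynomial.coeff_erase]
          split_ifs with hmk
          · exact mul_zero _
          · rw [Polynomial.coeff_eq_zero_of_degree_lt (hdeg.trans_le _), mul_zero]
            exact_mod_cast (show k + 1 ≤ m by omega)
        · have e1 : g * (Polynomial.C (g.coeff i) * f.erase k) =
              Polynomial.C (g.coeff i) * (g * f) -
                g * Polynomial.monomial k (g.coeff i * f.coeff k) := by
            have e2 := Polynomial.monomial_add_erase f k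
            rw [← Polynomial.C_mul_monomial]
            nth_rewrite 2 [← e2]
            ring
          rw [e1]
          refine sub_mem ?_ ?_
          · rw [pow_succ' q (n + 1), Ideal.map_mul]
            exact Ideal.mul_mem_mul (Ideal.mem_map_of_mem _ hgi) hgf
          · rw [pow_succ' q (n + 1), Ideal.map_mul]
            refine Ideal.mul_mem_mul hgq ?_
            rw [← Polynomial.C_mul_X_pow_eq_monomial]
            exact Ideal.mul_mem_right _ _ (Ideal.mem_map_of_mem _ hlead)
      intro j
      by_cases hjk : j = k
      · rw [hjk]; exact hlead
      · have := Ideal.mem_map_C_iff.mp key j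
        rwa [Polynomial.coeff_C_mul, Polynomial.coeff_erase, if_neg hjk] at this

end RatliffRush

/-! ### Generating series and the second coefficient -/

section Series

/-- The generating series of `a` is `h(t) / (1 - t)^(d + 1)` for an integral polynomial `h` with
`h''(1) / 2 ≤ 0`. For `a n` the length of `R ⧸ qⁿ⁺¹`, this `h` is the `h`-polynomial of `q`. -/
def HasNonposSecondCoeff (d : ℕ) (a : ℕ → ℤ) : Prop :=
  ∃ h : ℤ[X], PowerSeries.mk a * (1 - PowerSeries.X) ^ (d + 1) = (h : PowerSeries ℤ) ∧
    (Polynomial.hasseDeriv 2 h).eval 1 ≤ 0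

theorem eval_one_hasseDeriv_two (h : ℤ[X]) {N : ℕ} (hN : h.natDegree < N) :
    (Polynomial.hasseDeriv 2 h).eval 1 = ∑ n ∈ Finset.range N, (n.choose 2 : ℤ) * h.coeff n := by
  rw [Polynomial.hasseDeriv_apply, Polynomial.sum_over_range' _ (by simp) N hN,
    Polynomial.eval_finsetSum]
  simp

theorem exists_coe_eq_mk {v : ℕ → ℤ} {N : ℕ} (hv : ∀ n ≥ N, v n = 0) :
    ∃ p : ℤ[X], PowerSeries.mk v = (p : PowerSeries ℤ) ∧ p.natDegree < N + 1 ∧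
      ∀ n, p.coeff n = v n := by
  have hc : ∀ n, (PowerSeries.trunc N (PowerSeries.mk v)).coeff n = v n := by
    intro n
    rw [PowerSeries.coeff_trunc, PowerSeries.coeff_mk]
    split_ifs with h
    · rfl
    · exact (hv n (not_lt.mp h)).symm
  refine ⟨PowerSeries.trunc N (PowerSeries.mk v), ?_, ?_, hc⟩
  · ext n
    rw [Polynomial.coeff_coe, hc, PowerSeries.coeff_mk]
  · refine Nat.lt_succ_of_le (Polynomial.natDegree_le_iff_coeff_eq_zero.mpr fun n hn ↦ ?_)
    rw [hc, hv n hn.le]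

theorem mk_succ_mul_one_sub_X (a : ℕ → ℤ) (h0 : a 0 = 0) :
    PowerSeries.mk (fun n ↦ a (n + 1)) * (1 - PowerSeries.X) =
      PowerSeries.mk fun n ↦ a (n + 1) - a n := by
  ext n
  rw [mul_sub, mul_one, map_sub, PowerSeries.coeff_mk, PowerSeries.coeff_mk]
  cases n with
  | zero => simp [h0]
  | succ n => rw [PowerSeries.coeff_succ_mul_X, PowerSeries.coeff_mk]

/-- A nonincreasing Hilbert function in dimension one. -/
theorem hasNonposSecondCoeff_one_of_antitone (a : ℕ → ℕ) (h0 : a 0 = 0)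
    (H : ℕ → ℕ) (hH : ∀ n, a (n + 1) = a n + H n) (hanti : Antitone H) :
    HasNonposSecondCoeff 1 fun n ↦ (a (n + 1) : ℤ) := by
  obtain ⟨N, hN⟩ : ∃ N, ∀ n ≥ N, H n = H N := by
    obtain ⟨N, hN⟩ := WellFoundedGT.monotone_chain_condition
      (⟨fun n ↦ OrderDual.toDual (H n), fun _ _ h ↦ hanti h⟩ : ℕ →o ℕᵒᵈ)
    exact ⟨N, fun n hn ↦ (hN n hn).symm⟩
  -- Shifted by one with value `0` at `0`, so that the coefficients of `h` are its differences; the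
  -- only one that may be positive, `H 0`, is killed by `C(0,2) = 0`.
  let b : ℕ → ℤ := fun n ↦ if n = 0 then 0 else H (n - 1)
  obtain ⟨p, hp, hdeg, hcoeff⟩ := exists_coe_eq_mk (v := fun n ↦ b (n + 1) - b n) (N := N + 1)
    (fun n hn ↦ by
      have h1 : H n = H N := hN n (by omega)
      have h2 : H (n - 1) = H N := hN _ (by omega)
      simp [b, show n ≠ 0 by omega, h1, h2])
  refine ⟨p, ?_, ?_⟩
  · have e1 := mk_succ_mul_one_sub_X (fun n ↦ (a n : ℤ)) (by simp [h0])
    have e2 := mk_succ_mul_one_sub_X b (by simp [b])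
    have e3 : (fun n ↦ (a (n + 1) : ℤ) - a n) = fun n ↦ b (n + 1) := by
      funext n
      simp [b, hH]
    rw [pow_two, ← mul_assoc, e1, e3, e2, hp]
  · rw [eval_one_hasseDeriv_two p hdeg]
    refine Finset.sum_nonpos fun n _ ↦ ?_
    rcases Nat.eq_zero_or_pos n with rfl | hn
    · simp
    · refine mul_nonpos_of_nonneg_of_nonpos (by positivity) ?_
      have : H n ≤ H (n - 1) := hanti (by omega)
      simp only [hcoeff, b, Nat.add_sub_cancel, Nat.succ_ne_zero, if_false, hn.ne']
      omega

/-- Both derivatives must fall on a factor `(1 - X)²`, so the value is that of `(1 - X)ᵏ p` at `1`: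
`p(1)` if `k = 0`, and `0` otherwise. -/
theorem eval_one_hasseDeriv_two_mul_nonneg (p : ℤ[X]) (hp : ∀ n, 0 ≤ p.coeff n) (k : ℕ) :
    0 ≤ (Polynomial.hasseDeriv 2 ((1 - Polynomial.X) ^ (k + 2) * p)).eval 1 := by
  obtain ⟨c, hc⟩ : ∃ c : ℤ[X], c = (1 - Polynomial.X) ^ k * p := ⟨_, rfl⟩
  have hc1 : 0 ≤ c.eval 1 := by
    rw [hc, Polynomial.eval_mul]
    have : 0 ≤ p.eval 1 := by
      rw [Polynomial.eval_eq_sum_range]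
      exact Finset.sum_nonneg fun n _ ↦ by simpa using hp n
    refine mul_nonneg ?_ this
    rcases Nat.eq_zero_or_pos k with rfl | hk
    · simp
    · simp [hk.ne']
  have e : (2 : ℤ) * (Polynomial.hasseDeriv 2 ((1 - Polynomial.X) ^ (k + 2) * p)).eval 1 =
      2 * c.eval 1 := by
    have h2 := congr(($(Polynomial.factorial_smul_hasseDeriv (R := ℤ) (k := 2))
      ((1 - Polynomial.X) ^ (k + 2) * p)).eval 1)
    have e1 : (1 - Polynomial.X) ^ (k + 2) * p = (1 - Polynomial.X) ^ 2 * c := by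
      rw [hc]; ring
    rw [e1] at h2 ⊢
    norm_num [Nat.factorial] at h2
    rw [h2]
    simp [Polynomial.derivative_mul, Polynomial.derivative_pow]
  linarith

/-- Passage from a superficial quotient: the second coefficient does not increase. -/
theorem HasNonposSecondCoeff.of_superficial {d : ℕ} {a a' : ℕ → ℕ} (h0 : a 0 = 0)
    (hle : ∀ n, a (n + 1) ≤ a n + a' n) {N : ℕ} (heq : ∀ n ≥ N, a (n + 1) = a n + a' n)
    (h' : HasNonposSecondCoeff (d + 1) fun n ↦ (a' n : ℤ)) :
    HasNonposSecondCoeff (d + 2) fun n ↦ (a (n + 1) : ℤ) := by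
  obtain ⟨p', hp', hneg⟩ := h'
  obtain ⟨v, hv, -, hcoeff⟩ := exists_coe_eq_mk
    (v := fun n ↦ (a n : ℤ) + a' n - a (n + 1)) (N := N) (fun n hn ↦ by rw [heq n hn]; simp)
  -- `v` records the failure of exactness on the left, a nonnegative defect that vanishes from `N`
  -- on.
  refine ⟨p' - (1 - Polynomial.X) ^ (d + 2) * v, ?_, ?_⟩
  · have e1 := mk_succ_mul_one_sub_X (fun n ↦ (a n : ℤ)) (by simp [h0])
    have e2 : PowerSeries.mk (fun n ↦ (a (n + 1) : ℤ) - a n) =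
        PowerSeries.mk (fun n ↦ (a' n : ℤ)) - v := by
      rw [← hv]
      ext n
      simp only [map_sub, PowerSeries.coeff_mk]
      ring
    rw [pow_succ', ← mul_assoc, e1, e2, sub_mul, hp']
    push_cast
    ring
  · have := eval_one_hasseDeriv_two_mul_nonneg v
      (fun n ↦ by rw [hcoeff]; have := hle n; omega) d
    rw [map_sub, Polynomial.eval_sub]
    linarith

end Series

/-! ### Colengths and Hilbert functions -/

section Colength

open IsLocalRing

/-- The length of `R ⧸ I`. -/
noncomputable def colength {R : Type*} [CommRing R] (I : Ideal R) : ℕ :=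
  (Module.length R (R ⧸ I)).toNat

variable {R : Type*} [CommRing R]

theorem colength_top : colength (⊤ : Ideal R) = 0 := by
  have : Subsingleton (R ⧸ (⊤ : Ideal R)) := Ideal.Quotient.subsingleton_iff.mpr rfl
  simp [colength]

theorem length_quotient_ne_top_of_radical_eq [IsNoetherianRing R] [IsLocalRing R] {I : Ideal R}
    (hI : I.radical = maximalIdeal R) : Module.length R (R ⧸ I) ≠ ⊤ := by
  have hmem : maximalIdeal R ∈ I.minimalPrimes := by
    rw [← Ideal.radical_minimalPrimes, hI, Ideal.minimalPrimes_eq_subsingleton_self]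
    rfl
  have := IsLocalRing.quotient_artinian_of_mem_minimalPrimes_of_isLocalRing I hmem
  rw [Module.length_eq_of_surjective (R := R ⧸ I) (S := R) (M := R ⧸ I)
    Ideal.Quotient.mk_surjective]
  exact Module.length_ne_top

theorem length_quotient_pow_ne_top [IsNoetherianRing R] [IsLocalRing R] {q : Ideal R}
    (hq : q.radical = maximalIdeal R) (n : ℕ) : Module.length R (R ⧸ q ^ n) ≠ ⊤ := by
  rcases Nat.eq_zero_or_pos n with rfl | hn
  · have : Subsingleton (R ⧸ q ^ 0) := Ideal.Quotient.subsingleton_iff.mpr (by simp)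
    simp
  · exact length_quotient_ne_top_of_radical_eq (by rw [Ideal.radical_pow q hn.ne', hq])

/-- Multiplication by `y` as a map `R ⧸ I → R ⧸ J`, when `y I ⊆ J`. -/
def mulQuotient (I J : Ideal R) (y : R) (h : ∀ a ∈ I, y * a ∈ J) : (R ⧸ I) →ₗ[R] R ⧸ J :=
  Submodule.mapQ I J (LinearMap.mulLeft R y) h

theorem exact_mulQuotient (I J : Ideal R) (y : R) (h : ∀ a ∈ I, y * a ∈ J) :
    Function.Exact (LinearMap.range (mulQuotient I J y h)).subtype
      (Submodule.factor (le_sup_left : J ≤ J ⊔ Ideal.span {y})) := by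
  rw [LinearMap.exact_iff, Submodule.range_subtype]
  ext b
  obtain ⟨b, rfl⟩ := Submodule.Quotient.mk_surjective _ b
  rw [LinearMap.mem_ker, LinearMap.mem_range]
  change Submodule.Quotient.mk b = 0 ↔ _
  rw [Submodule.Quotient.mk_eq_zero, Submodule.mem_sup]
  constructor
  · rintro ⟨j, hj, c, hc, rfl⟩
    obtain ⟨r, rfl⟩ := Ideal.mem_span_singleton'.mp hc
    refine ⟨Submodule.Quotient.mk r, (Submodule.Quotient.eq _).mpr ?_⟩
    simpa [mul_comm] using hj
  · rintro ⟨r, hr⟩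
    obtain ⟨r, rfl⟩ := Submodule.Quotient.mk_surjective _ r
    have := (Submodule.Quotient.eq _).mp hr
    refine ⟨b - y * r, by simpa using neg_mem this, y * r,
      Ideal.mul_mem_right _ _ (Ideal.mem_span_singleton_self y), by ring⟩

/-- Additivity of length along `R/I → R/J → R/(J + (y)) → 0`; the colon condition is injectivity of
the first map. -/
theorem colength_le_add {I J : Ideal R} {y : R} (h : ∀ a ∈ I, y * a ∈ J)
    (hI : Module.length R (R ⧸ I) ≠ ⊤) (hJ : Module.length R (R ⧸ J) ≠ ⊤) :
    colength J ≤ colength I + colength (J ⊔ Ideal.span {y}) ∧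
      ((∀ a, y * a ∈ J → a ∈ I) →
        colength J = colength I + colength (J ⊔ Ideal.span {y})) := by
  set f := mulQuotient I J y h
  have hsurj : Function.Surjective
      (Submodule.factor (le_sup_left : J ≤ J ⊔ Ideal.span {y})) :=
    Submodule.factor_surjective _
  have hadd := Module.length_eq_add_of_exact _ _ (Submodule.subtype_injective _) hsurj
    (exact_mulQuotient I J y h)
  have hle := Module.length_le_of_surjective f.rangeRestrict f.surjective_rangeRestrict
  have hK : Module.length R (R ⧸ (J ⊔ Ideal.span {y})) ≠ ⊤ :=
    ne_top_of_le_ne_top hJ (Module.length_le_of_surjective _ hsurj)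
  rw [colength, colength, colength, hadd, ENat.toNat_add (ne_top_of_le_ne_top hI hle) hK]
  refine ⟨Nat.add_le_add_right (ENat.toNat_le_toNat hle hI) _, fun hinj ↦ ?_⟩
  have hf : Function.Injective f := by
    refine (injective_iff_map_eq_zero f).mpr fun a ha ↦ ?_
    obtain ⟨a, rfl⟩ := Submodule.Quotient.mk_surjective _ a
    exact (Submodule.Quotient.mk_eq_zero _).mpr (hinj a ((Submodule.Quotient.mk_eq_zero _).mp ha))
  rw [← (LinearEquiv.ofInjective f hf).length_eq]

/-- Colengths of ideals containing the kernel do not change under a surjection. -/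
theorem colength_map_quotientMk (I J : Ideal R) :
    colength (J.map (Ideal.Quotient.mk I)) = colength (J ⊔ I) := by
  rw [colength, colength, ← Module.length_eq_of_surjective (R := R ⧸ I) (S := R)
    (M := (R ⧸ I) ⧸ J.map (Ideal.Quotient.mk I)) Ideal.Quotient.mk_surjective, sup_comm]
  exact congrArg ENat.toNat ((DoubleQuot.quotQuotEquivQuotSupₐ R I J).toLinearEquiv).length_eq

/-- Flat base change multiplies length by that of the closed fibre `S/𝔪S`, here a field. -/
theorem colength_map_of_flat {R S : Type*} [CommRing R] [CommRing S] [IsLocalRing R]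
    [IsLocalRing S] [Algebra R S] [IsLocalHom (algebraMap R S)] [Module.Flat R S]
    (hm : (maximalIdeal R).map (algebraMap R S) = maximalIdeal S) (I : Ideal R) :
    colength (I.map (algebraMap R S)) = colength I := by
  have h1 : Module.length S (S ⧸ (maximalIdeal R).map (algebraMap R S)) = 1 := by
    rw [hm]
    exact Module.length_eq_one_iff.mpr
      (isSimpleModule_iff_isCoatom.mpr (maximalIdeal.isMaximal S).out)
  rw [colength, colength,
    (Algebra.TensorProduct.quotIdealMapEquivTensorQuot S I).toLinearEquiv.length_eq,
    IsLocalRing.length_baseChange, h1, mul_one]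

theorem radical_eq_maximalIdeal [IsLocalRing R] {q : Ideal R} (hle : q ≤ maximalIdeal R)
    {k : ℕ} (hk : maximalIdeal R ^ k ≤ q) : q.radical = maximalIdeal R :=
  le_antisymm ((maximalIdeal.isMaximal R).isPrime.radical_le_iff.mpr hle)
    fun _ ha ↦ ⟨k, hk (Ideal.pow_mem_pow ha k)⟩

theorem maximalIdeal_quotient [IsLocalRing R] (I : Ideal R) [IsLocalRing (R ⧸ I)] :
    maximalIdeal (R ⧸ I) = (maximalIdeal R).map (Ideal.Quotient.mk I) := by
  have hlocal : IsLocalHom (Ideal.Quotient.mk I) :=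
    IsLocalHom.of_surjective _ Ideal.Quotient.mk_surjective
  refine le_antisymm (fun a ha ↦ ?_) (((local_hom_TFAE (Ideal.Quotient.mk I)).out 0 2).mp hlocal)
  obtain ⟨a, rfl⟩ := Ideal.Quotient.mk_surjective a
  exact Ideal.mem_map_of_mem _ fun h ↦ ha (h.map _)

theorem maximalIdeal_quotient_pow_le_map [IsLocalRing R] (I : Ideal R) [IsLocalRing (R ⧸ I)]
    {q : Ideal R} {k : ℕ} (hk : maximalIdeal R ^ k ≤ q) :
    maximalIdeal (R ⧸ I) ^ k ≤ q.map (Ideal.Quotient.mk I) := by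
  rw [maximalIdeal_quotient, ← Ideal.map_pow]
  exact Ideal.map_mono hk

theorem hilbertFunction_adicFiltration (q : Ideal R) (n : ℕ) :
    hilbertFunction (adicFiltration q) n = (Module.length R
      ((q ^ n : Ideal R) ⧸ (q ^ (n + 1)).submoduleOf (q ^ n))).toNat := by
  have hN : ∀ n, (adicFiltration q).N n = q ^ n := fun n ↦ by simp [Ideal.stableFiltration]
  rw [hilbertFunction, hN, hN]

theorem length_quotient_eq_add_of_le {I J : Ideal R} (hle : J ≤ I) :
    Module.length R (R ⧸ J) = Module.length R (I ⧸ J.submoduleOf I) + Module.length R (R ⧸ I) := by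
  let f : I →ₗ[R] R ⧸ J := J.mkQ ∘ₗ I.subtype
  have hker : LinearMap.ker f = J.submoduleOf I := by
    rw [LinearMap.ker_comp, Submodule.ker_mkQ]
    rfl
  have hex : Function.Exact (LinearMap.range f).subtype (Submodule.factor hle) := by
    rw [LinearMap.exact_iff, Submodule.range_subtype, LinearMap.range_comp,
      Submodule.range_subtype]
    ext b
    obtain ⟨b, rfl⟩ := Submodule.Quotient.mk_surjective _ b
    rw [LinearMap.mem_ker]
    change Submodule.Quotient.mk b = 0 ↔ _
    rw [Submodule.Quotient.mk_eq_zero]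
    refine ⟨fun hb ↦ ⟨b, hb, rfl⟩, ?_⟩
    rintro ⟨c, hc, hcb⟩
    have := hle ((Submodule.Quotient.eq _).mp hcb)
    exact (Submodule.sub_mem_iff_right _ hc).mp this
  rw [Module.length_eq_add_of_exact _ _ (Submodule.subtype_injective _)
    (Submodule.factor_surjective hle) hex, ← f.quotKerEquivRange.length_eq, hker]

theorem colength_pow_succ {q : Ideal R} {n : ℕ} (h : Module.length R (R ⧸ q ^ (n + 1)) ≠ ⊤) :
    colength (q ^ (n + 1)) = colength (q ^ n) + hilbertFunction (adicFiltration q) n := by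
  have hadd := length_quotient_eq_add_of_le (Ideal.pow_le_pow_right n.le_succ : q ^ (n + 1) ≤ q ^ n)
  rw [hadd] at h
  rw [colength, colength, hilbertFunction_adicFiltration, hadd, ENat.toNat_add, add_comm]
  · exact fun h' ↦ h (by rw [h', top_add])
  · exact fun h' ↦ h (by rw [h', add_top])

/-- The Hilbert function of a principal ideal is nonincreasing. -/
theorem hilbertFunction_antitone_of_span_singleton [IsNoetherianRing R] [IsLocalRing R] {y : R}
    {q : Ideal R} (hy : q = Ideal.span {y}) (hq : q.radical = maximalIdeal R) :
    Antitone (hilbertFunction (adicFiltration q)) := by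
  refine antitone_nat_of_succ_le fun n ↦ ?_
  have hyq : y ∈ q := hy ▸ Ideal.mem_span_singleton_self y
  have hmul : ∀ n, ∀ a ∈ q ^ n, LinearMap.mulLeft R y a ∈ q ^ (n + 1) := fun n a ha ↦ by
    rw [pow_succ']
    exact Ideal.mul_mem_mul hyq ha
  -- Multiplication by `y`, onto because `qⁿ⁺¹ = y qⁿ`.
  let f := Submodule.mapQ ((q ^ (n + 1)).submoduleOf (q ^ n))
    ((q ^ (n + 2)).submoduleOf (q ^ (n + 1))) ((LinearMap.mulLeft R y).restrict (hmul n))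
    (fun a ha ↦ hmul (n + 1) _ ha)
  have hf : Function.Surjective f := by
    intro b
    obtain ⟨⟨b, hb⟩, rfl⟩ := Submodule.Quotient.mk_surjective _ b
    have hb' := hb
    rw [pow_succ', hy, Ideal.mem_span_singleton_mul] at hb'
    obtain ⟨a, ha, rfl⟩ := hb'
    exact ⟨Submodule.Quotient.mk ⟨a, by rwa [hy]⟩, rfl⟩
  rw [hilbertFunction_adicFiltration, hilbertFunction_adicFiltration]
  refine ENat.toNat_le_toNat (Module.length_le_of_surjective f hf) fun h ↦ ?_
  refine length_quotient_pow_ne_top hq (n + 1) ?_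
  rw [length_quotient_eq_add_of_le (Ideal.pow_le_pow_right n.le_succ : q ^ (n + 1) ≤ q ^ n), h,
    top_add]

end Colength

/-! ### The Nagata extension -/

section GenericExtension

open IsLocalRing

universe u

variable (R : Type u) [CommRing R] [IsLocalRing R]

/-- The Nagata extension `R(X)`, the localization of `R[X]` at `𝔪 R[X]`. -/
abbrev NagataRing : Type u :=
  Localization.AtPrime ((maximalIdeal R).map (Polynomial.C : R →+* R[X]))

theorem algebraMap_nagataRing : algebraMap R (NagataRing R) =
    (algebraMap R[X] (NagataRing R)).comp Polynomial.C :=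
  IsScalarTower.algebraMap_eq R R[X] (NagataRing R)

instance : Module.Flat R (NagataRing R) :=
  have : Module.Flat R[X] (NagataRing R) := IsLocalization.flat _
    ((maximalIdeal R).map (Polynomial.C : R →+* R[X])).primeCompl
  Module.Flat.trans R R[X] (NagataRing R)

theorem map_maximalIdeal_nagataRing :
    (maximalIdeal R).map (algebraMap R (NagataRing R)) = maximalIdeal (NagataRing R) := by
  rw [algebraMap_nagataRing, ← Ideal.map_map]
  exact IsLocalization.AtPrime.map_eq_maximalIdeal _ _

instance : IsLocalHom (algebraMap R (NagataRing R)) :=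
  ((local_hom_TFAE (algebraMap R (NagataRing R))).out 0 2).mpr (map_maximalIdeal_nagataRing R).le

end GenericExtension

/-! ### Reduction modulo the generic element and induction -/

section Induction

open IsLocalRing RingTheory.Sequence

universe u

theorem algebraMap_genericElement_mem_nonZeroDivisors {R : Type u} [CommRing R] [IsLocalRing R]
    {d : ℕ} (x : Fin d → R) (h : ∀ a : R, (∀ b ∈ Ideal.span (Set.range x), b * a = 0) → a = 0) :
    algebraMap R[X] (NagataRing R) (genericElement x) ∈ nonZeroDivisors (NagataRing R) :=
  IsLocalization.map_nonZeroDivisors_le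
    ((maximalIdeal R).map (Polynomial.C : R →+* R[X])).primeCompl _
    ⟨_, genericElement_mem_nonZeroDivisors x h, rfl⟩

theorem mem_map_pow_of_algebraMap_genericElement_mul_mem {R : Type u} [CommRing R]
    [IsLocalRing R] {d : ℕ} (x : Fin d → R) {n₀ : ℕ}
    (h : ∀ n ≥ n₀, ∀ a : R, (∀ b ∈ Ideal.span (Set.range x),
      b * a ∈ Ideal.span (Set.range x) ^ (n + 1)) → a ∈ Ideal.span (Set.range x) ^ n)
    {n : ℕ} (hn : n₀ ≤ n) (a : NagataRing R)
    (ha : algebraMap R[X] (NagataRing R) (genericElement x) * a ∈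
      (Ideal.span (Set.range x) ^ (n + 1)).map (algebraMap R (NagataRing R))) :
    a ∈ (Ideal.span (Set.range x) ^ n).map (algebraMap R (NagataRing R)) := by
  set M := ((maximalIdeal R).map (Polynomial.C : R →+* R[X])).primeCompl
  rw [algebraMap_nagataRing, ← Ideal.map_map] at ha ⊢
  obtain ⟨⟨⟨p, hp⟩, u⟩, hu⟩ := (IsLocalization.mem_map_algebraMap_iff M _).mp ha
  obtain ⟨⟨f, s⟩, hs⟩ := IsLocalization.surj M a
  dsimp only at hu hs
  obtain ⟨c, hc⟩ := (IsLocalization.eq_iff_exists M (NagataRing R)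
    (x := genericElement x * f * u) (y := p * s)).mp (by
      rw [map_mul, map_mul, map_mul, ← hs, ← hu]; ring)
  have hmem : genericElement x * (c * f * u) ∈
      (Ideal.span (Set.range x) ^ (n + 1)).map Polynomial.C := by
    rw [show genericElement x * (c * f * u) = c * (p * s) by rw [← hc]; ring]
    exact Ideal.mul_mem_left _ _ (Ideal.mul_mem_right _ _ hp)
  refine (IsLocalization.mem_map_algebraMap_iff M _).mpr
    ⟨⟨⟨_, mem_map_pow_of_genericElement_mul_mem x h hn _ hmem⟩, s * c * u⟩, ?_⟩
  simp only [Submonoid.coe_mul, map_mul, ← hs]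
  ring

/-- Dividing out a regular element lowers the depth by at most one. -/
theorem exists_isRegular_quotient_span {R : Type u} [CommRing R] [IsLocalRing R]
    [IsNoetherianRing R] {y : R} (hy : y ∈ maximalIdeal R) (hreg : y ∈ nonZeroDivisors R)
    [IsLocalRing (R ⧸ Ideal.span {y})] {n : ℕ}
    (h : ∃ rs : List R, rs.length = n + 1 ∧ (∀ r ∈ rs, r ∈ maximalIdeal R) ∧ IsRegular R rs) :
    ∃ rs : List (R ⧸ Ideal.span {y}), rs.length = n ∧
      (∀ r ∈ rs, r ∈ maximalIdeal (R ⧸ Ideal.span {y})) ∧ IsRegular (R ⧸ Ideal.span {y}) rs := by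
  obtain ⟨rs, hlen, hmem, hrs⟩ := h
  -- Rees: a regular sequence of length `n + 1` means `Extⁱ(R/𝔪, R) = 0` for `i ≤ n`. The long exact
  -- sequence of multiplication by `y` carries this to `R/(y)` for `i < n`.
  have hext := ModuleCat.subsingleton_ext_of_exists_isRegular (maximalIdeal R)
    (ModuleCat.of R (R ⧸ maximalIdeal R))
    (by rw [Module.support_eq_zeroLocus, Ideal.annihilator_quotient]) (ModuleCat.of R R)
    (Submodule.top_ne_ideal_smul_of_le_jacobson_annihilator (M := R)
      (maximalIdeal_le_jacobson _)).symm.lt_top rs hmem hrs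
  have hyr : IsSMulRegular (ModuleCat.of R R) y := IsSMulRegular.of_right_eq_zero_of_smul
    fun a ha ↦ hreg.1 a ha
  have hext' : ∀ i < n, Subsingleton (CategoryTheory.Abelian.Ext
      (ModuleCat.of R (R ⧸ maximalIdeal R)) (ModuleCat.of R (QuotSMulTop y R)) i) := by
    intro i hi
    have zero1 := AddCommGrpCat.isZero_of_iff_subsingleton.mpr (hext i (by omega))
    have zero2 := AddCommGrpCat.isZero_of_iff_subsingleton.mpr (hext (i + 1) (by omega))
    exact AddCommGrpCat.subsingleton_of_isZero <|
      CategoryTheory.ShortComplex.Exact.isZero_of_both_zeros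
        ((CategoryTheory.Abelian.Ext.covariant_sequence_exact₃' (ModuleCat.of R (R ⧸ maximalIdeal R))
          hyr.smulShortComplex_shortExact) i (i + 1) rfl)
        (zero1.eq_zero_of_src _) (zero2.eq_zero_of_tgt _)
  have hnontriv : Nontrivial (QuotSMulTop y R) := nontrivial_quotSMulTop_of_mem_maximalIdeal R hy
  obtain ⟨ts, htlen, htmem, hts⟩ := ModuleCat.exists_isRegular_of_exists_subsingleton_ext
    (maximalIdeal R) n (ModuleCat.of R (QuotSMulTop y R))
    (Submodule.top_ne_ideal_smul_of_le_jacobson_annihilator (M := QuotSMulTop y R)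
      (maximalIdeal_le_jacobson _)).symm.lt_top
    (ModuleCat.of R (R ⧸ maximalIdeal R))
    (by rw [Module.support_eq_zeroLocus, Ideal.annihilator_quotient]) hext'
  have e : QuotSMulTop y R ≃ₗ[R] R ⧸ Ideal.span {y} := Submodule.quotEquivOfEq _ _ (by
    rw [← Submodule.ideal_span_singleton_smul, smul_eq_mul, Ideal.mul_top])
  have hweak : IsWeaklyRegular (R ⧸ Ideal.span {y})
      (ts.map (algebraMap R (R ⧸ Ideal.span {y}))) :=
    (isWeaklyRegular_map_algebraMap_iff _ _ ts).mpr
      ((e.isWeaklyRegular_congr ts).mp hts.toIsWeaklyRegular)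
  have hmax : ∀ t ∈ ts.map (algebraMap R (R ⧸ Ideal.span {y})),
      t ∈ maximalIdeal (R ⧸ Ideal.span {y}) := by
    intro t ht
    obtain ⟨s, hs, rfl⟩ := List.mem_map.mp ht
    rw [maximalIdeal_quotient]
    exact Ideal.mem_map_of_mem _ (htmem s hs)
  exact ⟨_, by simpa using htlen, hmax,
    IsRegular.of_isWeaklyRegular_of_mem_maximalIdeal _ hmax hweak⟩

theorem isLocalRing_quotient_span {R : Type u} [CommRing R] [IsLocalRing R] {y : R}
    (hy : y ∈ maximalIdeal R) : IsLocalRing (R ⧸ Ideal.span {y}) := by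
  have hspan : Ideal.span {y} ≠ ⊤ := fun h ↦ by
    have : Ideal.span {y} ≤ maximalIdeal R := (Ideal.span_singleton_le_iff_mem _).mpr hy
    rw [h, top_le_iff] at this
    exact (maximalIdeal.isMaximal R).ne_top this
  have : Nontrivial (R ⧸ Ideal.span {y}) := Ideal.Quotient.nontrivial_iff.mpr hspan
  exact IsLocalRing.of_surjective' (Ideal.Quotient.mk _) Ideal.Quotient.mk_surjective

/-- Division by a superficial nonzerodivisor `y ∈ q`. -/
theorem hasNonposSecondCoeff_of_quotient {d : ℕ} {R : Type u} [CommRing R] [IsLocalRing R]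
    [IsNoetherianRing R] {q : Ideal R} (hq : q.radical = maximalIdeal R) {y : R} (hyq : y ∈ q)
    {n₀ : ℕ} (hsup : ∀ n ≥ n₀, ∀ a, y * a ∈ q ^ (n + 1) → a ∈ q ^ n)
    (h : HasNonposSecondCoeff (d + 1) fun n ↦
      (colength (q.map (Ideal.Quotient.mk (Ideal.span {y})) ^ (n + 1)) : ℤ)) :
    HasNonposSecondCoeff (d + 2) fun n ↦ (colength (q ^ (n + 1)) : ℤ) := by
  simp only [← Ideal.map_pow, colength_map_quotientMk] at h
  have hmul : ∀ n, ∀ a ∈ q ^ n, y * a ∈ q ^ (n + 1) := fun n a ha ↦ by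
    rw [pow_succ']
    exact Ideal.mul_mem_mul hyq ha
  have hfin := length_quotient_pow_ne_top hq
  exact HasNonposSecondCoeff.of_superficial (a := fun n ↦ colength (q ^ n))
    (a' := fun n ↦ colength (q ^ (n + 1) ⊔ Ideal.span {y}))
    (by simp only [pow_zero, Ideal.one_eq_top, colength_top])
    (fun n ↦ (colength_le_add (hmul n) (hfin n) (hfin (n + 1))).1)
    (fun n hn ↦ (colength_le_add (hmul n) (hfin n) (hfin (n + 1))).2 (hsup n hn)) h

theorem algebraMap_genericElement {R : Type u} [CommRing R] [IsLocalRing R] {d : ℕ}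
    (x : Fin d → R) : algebraMap R[X] (NagataRing R) (genericElement x) =
      ∑ i : Fin d, algebraMap R[X] (NagataRing R) (Polynomial.X ^ (i : ℕ)) *
        algebraMap R (NagataRing R) (x i) := by
  simp only [genericElement, map_sum, algebraMap_nagataRing, RingHom.comp_apply, ← map_mul,
    ← Polynomial.C_mul_X_pow_eq_monomial, mul_comm]

theorem algebraMap_genericElement_mem {R : Type u} [CommRing R] [IsLocalRing R] {d : ℕ}
    (x : Fin d → R) : algebraMap R[X] (NagataRing R) (genericElement x) ∈
      (Ideal.span (Set.range x)).map (algebraMap R (NagataRing R)) := by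
  rw [algebraMap_genericElement]
  exact Ideal.sum_mem _ fun i _ ↦
    Ideal.mul_mem_left _ _ (Ideal.mem_map_of_mem _ (Ideal.subset_span ⟨i, rfl⟩))

/-- Modulo the generic combination of `x₀, …, x_d`, the ideal generated by these elements is
generated by `x₁, …, x_d`. -/
theorem span_range_quotient_genericElement {R : Type u} [CommRing R] [IsLocalRing R] {d : ℕ}
    (x : Fin (d + 1) → R) :
    Ideal.span (Set.range fun i : Fin d ↦ Ideal.Quotient.mk
        (Ideal.span {algebraMap R[X] (NagataRing R) (genericElement x)})
          (algebraMap R (NagataRing R) (x i.succ))) =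
      ((Ideal.span (Set.range x)).map (algebraMap R (NagataRing R))).map
        (Ideal.Quotient.mk (Ideal.span {algebraMap R[X] (NagataRing R) (genericElement x)})) := by
  refine le_antisymm (Ideal.span_le.mpr ?_) ?_
  · rintro _ ⟨i, rfl⟩
    exact Ideal.mem_map_of_mem _ (Ideal.mem_map_of_mem _ (Ideal.subset_span ⟨_, rfl⟩))
  · rw [Ideal.map_span, Ideal.map_span, Ideal.span_le]
    rintro _ ⟨_, ⟨_, ⟨i, rfl⟩, rfl⟩, rfl⟩
    refine Fin.cases ?_ (fun i ↦ Ideal.subset_span ⟨i, rfl⟩) i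
    have h0 : Ideal.Quotient.mk (Ideal.span {algebraMap R[X] (NagataRing R) (genericElement x)})
        (algebraMap R[X] (NagataRing R) (genericElement x)) = 0 :=
      Ideal.Quotient.eq_zero_iff_mem.mpr (Ideal.mem_span_singleton_self _)
    -- The coefficient of `x 0` is `X⁰ = 1`, so modulo the generic element `x 0` is a combination of
    -- the others.
    conv at h0 => lhs; arg 2; rw [algebraMap_genericElement]
    rw [Fin.sum_univ_succ, map_add, Fin.val_zero, pow_zero, map_one, one_mul] at h0
    rw [SetLike.mem_coe, eq_neg_of_add_eq_zero_left h0]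
    refine neg_mem ?_
    rw [map_sum]
    refine Ideal.sum_mem _ fun i _ ↦ ?_
    rw [map_mul]
    exact Ideal.mul_mem_left _ _ (Ideal.subset_span ⟨i, rfl⟩)

theorem exists_isRegular_nagataRing {R : Type u} [CommRing R] [IsLocalRing R] {n : ℕ}
    (h : ∃ rs : List R, rs.length = n ∧ (∀ r ∈ rs, r ∈ maximalIdeal R) ∧ IsRegular R rs) :
    ∃ rs : List (NagataRing R), rs.length = n ∧ (∀ r ∈ rs, r ∈ maximalIdeal (NagataRing R)) ∧
      IsRegular (NagataRing R) rs := by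
  obtain ⟨rs, hlen, hmem, hrs⟩ := h
  have : Module.FaithfullyFlat R (NagataRing R) := Module.FaithfullyFlat.of_flat_of_isLocalHom
  refine ⟨rs.map (algebraMap R (NagataRing R)), by simpa using hlen, ?_, hrs.of_faithfullyFlat⟩
  intro r hr
  obtain ⟨s, hs, rfl⟩ := List.mem_map.mp hr
  rw [← map_maximalIdeal_nagataRing]
  exact Ideal.mem_map_of_mem _ (hmem s hs)

/-- Krull dimension is replaced by the number of generators, so no dimension has to be computed for
the quotients. -/
theorem hasNonposSecondCoeff_of_isRegular (d : ℕ) : ∀ (R : Type u) [CommRing R] [IsLocalRing R]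
    [IsNoetherianRing R] (x : Fin (d + 1) → R) (_ : Ideal.span (Set.range x) ≤ maximalIdeal R)
    (_ : ∃ k, maximalIdeal R ^ k ≤ Ideal.span (Set.range x))
    (_ : ∃ rs : List R, rs.length = d ∧ (∀ r ∈ rs, r ∈ maximalIdeal R) ∧ IsRegular R rs),
    HasNonposSecondCoeff (d + 1) fun n ↦ (colength (Ideal.span (Set.range x) ^ (n + 1)) : ℤ) := by
  induction d with
  | zero =>
    intro R _ _ _ x hle ⟨k, hk⟩ _
    have hrad := radical_eq_maximalIdeal hle hk
    refine hasNonposSecondCoeff_one_of_antitone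
      (fun n ↦ colength (Ideal.span (Set.range x) ^ n))
      (by simp only [pow_zero, Ideal.one_eq_top, colength_top]) _
      (fun n ↦ colength_pow_succ (length_quotient_pow_ne_top hrad (n + 1)))
      (hilbertFunction_antitone_of_span_singleton (y := x 0) ?_ hrad)
    refine congrArg Ideal.span (Set.ext fun a ↦ ⟨?_, fun ha ↦ ⟨0, ha.symm⟩⟩)
    rintro ⟨i, rfl⟩
    exact congrArg x (Fin.ext (by omega) : i = 0)
  | succ d ih =>
    intro R _ _ _ x hle ⟨k, hk⟩ hdepth
    obtain ⟨z, hzq, hz⟩ : ∃ z ∈ Ideal.span (Set.range x), z ∈ nonZeroDivisors R := by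
      obtain ⟨rs, hlen, hmem, hrs⟩ := hdepth
      obtain _ | ⟨r, rs⟩ := rs
      · simp at hlen
      · have hr : IsSMulRegular R r := ((isRegular_cons_iff _ _ _).mp hrs).1
        -- The regular element lies only in `𝔪`; its `k`-th power lies in `q` and stays regular.
        refine ⟨r ^ k, hk (Ideal.pow_mem_pow (hmem r List.mem_cons_self) k), ?_⟩
        exact pow_mem (mem_nonZeroDivisors_iff_right.mpr fun a ha ↦
          hr.right_eq_zero_of_smul (by rwa [smul_eq_mul, mul_comm])) k
    obtain ⟨n₀, hn₀⟩ := eventually_mem_pow_of_mul_mem_pow_succ _ hzq hz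
    have hyreg := algebraMap_genericElement_mem_nonZeroDivisors x fun a ha ↦ hz.1 a (ha z hzq)
    have hyq := algebraMap_genericElement_mem x
    have hQle := (Ideal.map_mono hle).trans (map_maximalIdeal_nagataRing R).le
    have hQk := Ideal.map_mono (f := algebraMap R (NagataRing R)) hk
    rw [Ideal.map_pow, map_maximalIdeal_nagataRing] at hQk
    have := isLocalRing_quotient_span (hQle hyq)
    have key := ih (NagataRing R ⧸ Ideal.span {algebraMap R[X] (NagataRing R) (genericElement x)})
      _ (by rw [span_range_quotient_genericElement x, maximalIdeal_quotient]
            exact Ideal.map_mono hQle)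
      ⟨k, by rw [span_range_quotient_genericElement x]
             exact maximalIdeal_quotient_pow_le_map _ hQk⟩
      (exists_isRegular_quotient_span (hQle hyq) hyreg (exists_isRegular_nagataRing hdepth))
    rw [span_range_quotient_genericElement x] at key
    have := hasNonposSecondCoeff_of_quotient (radical_eq_maximalIdeal hQle hQk) hyq
      (fun n hn a ha ↦ by
        rw [← Ideal.map_pow] at ha ⊢
        exact mem_map_pow_of_algebraMap_genericElement_mul_mem x hn₀ hn a ha) key
    simpa only [← Ideal.map_pow, colength_map_of_flat (map_maximalIdeal_nagataRing R)] using this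

end Induction

end HilbertCoeff

theorem mainTheorem8 {R : Type*} [CommRing R] [IsLocalRing R] [IsNoetherianRing R]
    (d : ℕ) (hd : ringKrullDim R = d) (hd2 : 2 ≤ d)
    (hdepth : ((d - 1 : ℕ) : ℕ∞) ≤ HilbertCoeff.depth R R)
    (q : Ideal R) (hq : HilbertCoeff.IsParameterIdeal q) :
    (∃ h : ℤ[X], HilbertCoeff.IsHPolynomial (HilbertCoeff.adicFiltration q) h) ∧
      HilbertCoeff.hilbertCoeff (HilbertCoeff.adicFiltration q) 2 ≤ 0 := by
  obtain ⟨hrad, d', x, hd', rfl⟩ := hq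
  obtain rfl : d' = d := by
    rw [hd] at hd'
    exact_mod_cast hd'
  obtain ⟨e, rfl⟩ : ∃ e, d' = e + 1 := ⟨d' - 1, by omega⟩
  have hrs : ∃ rs : List R, rs.length = e ∧ (∀ r ∈ rs, r ∈ IsLocalRing.maximalIdeal R) ∧
      RingTheory.Sequence.IsRegular R rs := by
    -- A strict bound below a supremum is attained by some sequence; its length exceeds `e - 1`,
    -- hence is at least `e`.
    have hlt : ((e - 1 : ℕ) : ℕ∞) < HilbertCoeff.depth R R :=
      lt_of_lt_of_le (by exact_mod_cast (by omega : e - 1 < e + 1 - 1)) hdepth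
    obtain ⟨rs, hlt⟩ := lt_iSup_iff.mp hlt
    obtain ⟨⟨hreg, hmem⟩, hlt⟩ := lt_iSup_iff.mp hlt
    have hlen : e - 1 < rs.length := by exact_mod_cast hlt
    have hmem' : ∀ r ∈ rs.take e, r ∈ IsLocalRing.maximalIdeal R :=
      fun r hr ↦ hmem r (List.mem_of_mem_take hr)
    refine ⟨rs.take e, by rw [List.length_take]; omega, hmem',
      RingTheory.Sequence.IsRegular.of_isWeaklyRegular_of_mem_maximalIdeal R hmem' ?_⟩
    have := hreg.toIsWeaklyRegular
    rw [← List.take_append_drop e rs, RingTheory.Sequence.isWeaklyRegular_append_iff] at this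
    exact this.1
  obtain ⟨k, hk⟩ := Ideal.exists_radical_pow_le_of_fg (Ideal.span (Set.range x))
    (IsNoetherian.noetherian _)
  rw [hrad] at hk
  obtain ⟨h, hh, hneg⟩ := HilbertCoeff.hasNonposSecondCoeff_of_isRegular e R x
    (hrad ▸ Ideal.le_radical) ⟨k, hk⟩ hrs
  have hdim : HilbertCoeff.dim R R = e + 1 := by
    rw [HilbertCoeff.dim, Module.supportDim_self_eq_ringKrullDim, hd]
    rfl
  have H : HilbertCoeff.IsHPolynomial
      (HilbertCoeff.adicFiltration (Ideal.span (Set.range x))) h := by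
    -- The Hilbert series is `1 - t` times the colength series, which absorbs the extra factor in
    -- `HasNonposSecondCoeff`.
    have hsucc := HilbertCoeff.mk_succ_mul_one_sub_X
      (fun n ↦ (HilbertCoeff.colength (Ideal.span (Set.range x) ^ n) : ℤ))
      (by simp only [pow_zero, Ideal.one_eq_top, HilbertCoeff.colength_top, Nat.cast_zero])
    have hseries : HilbertCoeff.hilbertSeries
        (HilbertCoeff.adicFiltration (Ideal.span (Set.range x))) = PowerSeries.mk fun n ↦
          (HilbertCoeff.colength (Ideal.span (Set.range x) ^ (n + 1)) : ℤ) -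
            HilbertCoeff.colength (Ideal.span (Set.range x) ^ n) := by
      refine congrArg PowerSeries.mk (funext fun n ↦ ?_)
      rw [HilbertCoeff.colength_pow_succ (HilbertCoeff.length_quotient_pow_ne_top hrad (n + 1)),
        Nat.cast_add, add_sub_cancel_left]
    rw [HilbertCoeff.IsHPolynomial, hdim, hseries, ← hsucc, mul_assoc, ← pow_succ', hh]
  refine ⟨⟨h, H⟩, ?_⟩
  rwa [HilbertCoeff.hilbertCoeff, H.eq_hPolynomial]
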